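/- Let $C$ be a linear code of length $n$ over $\mathbb{F}_3$, let $C^\perp$ be its dual with respect to the standard inner product, and let $d^\perp$ be the minimum distance of $C^\perp$. For a code $E$ write $E_u$ for the set of codewords of $E$ of Hamming weight $u$. Let $t\ge 0$ be an integer such that the following condition (the AM-condition) holds: $$d^\perp-t=\sharp\{u\mid C_u\neq\emptyset,\ 0<u\le n-t\}.$$ Let $D^\perp_w$ be the support design of $C^\perp$ for weight $w$, that is, the multiset of the supports of the codewords in $C^\perp_w$ (each support counted once for every such codeword). A $t$-design is a multiset of blocks, all of one size $k\ge t$ (repeated blocks are allowed), such that every $t$-set of coordinates is contained in the same positive number of blocks, counted with multiplicity. Let $d_1<d_2<d_3<\cdots$ be the nonzero weights of $C$ in increasing order, and put $\alpha_\ell=n-d_\ell-(t+1)$ and $\beta_\ell=d_\ell-(t+1)$. For a possibly negative integer $a$ and $i\ge 0$, $\binom{a}{i}=a(a-1)\cdots(a-i+1)/i!$. 1. Suppose $d^\perp-t=1$, and let $w\ge 0$ be an integer with $$\sum_{i+j=w}2^i\binom{\alpha_1}{i}(-1)^j\binom{\beta_1}{j}=0.$$ If $C^\perp_{w+t+1}\neq\emptyset$,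 then $D^\perp_{w+t+1}$ is a $(t+1)$-design. 2. Suppose $d^\perp-t=2$, and let $w\ge 0$ be an integer with $$\sum_{i+j=w}\left(2^i\binom{\alpha_1}{i}(-1)^j\binom{\beta_1}{j}-2^i\binom{\alpha_2}{i}(-1)^j\binom{\beta_2}{j}\right)=0.$$ If $C^\perp_{w+t+1}\neq\emptyset$, then $D^\perp_{w+t+1}$ is a $(t+1)$-design. 3. Suppose $d^\perp-t=3$, and let $w\ge 0$ be an integer with $$\sum_{i+j=w}\left(2^i\binom{\alpha_1}{i}(-1)^j\binom{\beta_1}{j}-\frac{d_3-d_1}{d_3-d_2}\,2^i\binom{\alpha_2}{i}(-1)^j\binom{\beta_2}{j}+\frac{d_2-d_1}{d_3-d_2}\,2^i\binom{\alpha_3}{i}(-1)^j\binom{\beta_3}{j}\right)=0.$$ If $C^\perp_{w+t+1}\neq\emptyset$, then $D^\perp_{w+t+1}$ is a $(t+1)$-design. -/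

import Mathlib

namespace TernaryCode

/-- The dual code `C^⊥` of a ternary linear code for the standard inner product on `𝔽₃ⁿ`. -/
def dual {n : ℕ} (C : Submodule (ZMod 3) (Fin n → ZMod 3)) :
    Submodule (ZMod 3) (Fin n → ZMod 3) where
  carrier := {x | ∀ c ∈ C, ∑ i, x i * c i = 0}
  add_mem' := by
    intro x y hx hy c hc
    simp only [Pi.add_apply, add_mul, Finset.sum_add_distrib, hx c hc, hy c hc, add_zero]
  zero_mem' := by
    intro c _
    simp
  smul_mem' := by
    intro a x hx c hc
    simp only [Pi.smul_apply, smul_eq_mul, mul_assoc, ← Finset.mul_sum, hx c hc, mul_zero]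

open Classical in
/-- `C_u`, the set of codewords of Hamming weight `u`. -/
noncomputable def weightClass {n : ℕ} (C : Submodule (ZMod 3) (Fin n → ZMod 3)) (u : ℕ) :
    Finset (Fin n → ZMod 3) :=
  Finset.univ.filter fun c => c ∈ C ∧ hammingNorm c = u

/-- The support of a vector. -/
def supp {n : ℕ} (c : Fin n → ZMod 3) : Finset (Fin n) :=
  Finset.univ.filter fun i => c i ≠ 0

/-- The blocks of the support design of `C` for weight `w`: the supports of the codewords of
weight `w`, each repeated as often as there are such codewords with that support. -/
noncomputable def supportDesign {n : ℕ} (C : Submodule (ZMod 3) (Fin n → ZMod 3)) (w : ℕ) :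
    Multiset (Finset (Fin n)) :=
  (weightClass C w).val.map supp

/-- The minimum distance of a linear code, that is, the minimum weight of a nonzero codeword
(with the junk value `0` for the zero code). -/
noncomputable def minDist {n : ℕ} (C : Submodule (ZMod 3) (Fin n → ZMod 3)) : ℕ :=
  sInf {u | ∃ c ∈ C, c ≠ 0 ∧ hammingNorm c = u}

/-- The weights of `C` in increasing order. The zeroth one is `0`, the weight of the zero
codeword; hence, for `1 ≤ l`, `weight C l` is the `l`-th nonzero weight of `C`. -/
noncomputable def weight {n : ℕ} (C : Submodule (ZMod 3) (Fin n → ZMod 3)) (l : ℕ) : ℕ :=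
  Nat.nth (fun u => (weightClass C u).Nonempty) l

open Classical in
/-- The condition `d^⊥ - t = #{u | C_u ≠ ∅, 0 < u ≤ n - t}`. -/
def AMCondition {n : ℕ} (C : Submodule (ZMod 3) (Fin n → ZMod 3)) (t : ℕ) : Prop :=
  (minDist (dual C) : ℤ) - t =
    ((Finset.Icc 1 (n - t)).filter fun u => (weightClass C u).Nonempty).card

/-- A `t`-design on a finite point set `V`, with repeated blocks allowed: a multiset of blocks,
all of one size `k ≥ t`, such that each `t`-set of points lies in the same positive number `l`
of blocks, counted with multiplicity. -/
def IsDesign {V : Type*} [DecidableEq V] (t : ℕ) (B : Multiset (Finset V)) : Prop :=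
  ∃ k l : ℕ, t ≤ k ∧ 0 < l ∧ (∀ b ∈ B, b.card = k) ∧
    ∀ T : Finset V, T.card = t → (B.filter fun b => T ⊆ b).card = l

end TernaryCode

namespace TernaryCode

open Finset Polynomial

variable {n : ℕ}

/-! This is the Assmus–Mattson argument, pushed one step beyond the strength `t` that it gives
directly. Write `P_T` and `N_T` for the punctured and covering enumerators of `C^⊥`, and `s = d^⊥ -
t`. The MacWilliams identity (`card_mul_puncturedEnumerator_dual`) expresses `P_T` through the
polynomials `(1 + 2X)^(n-|T|-d) (1 - X)^d`, with coefficients counting the codewords of `C` that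
vanish on `T`.

For `|T| = t`, only `s` nonzero weights occur and `P_T ≡ 1` modulo `X^s`. By
`eq_zero_of_X_pow_dvd_sum` this fixes the coefficients, so `P_T` does not depend on `T`.
Inclusion-exclusion carries this over to `N_S` for all `|S| ≤ t`.

For `|T| = |T'| = t + 1`, the contributions of proper subsets therefore cancel, leaving `X^(t+1)
(P_T - P_T') = (1 - X)^(t+1) (N_T - N_T')`. Dividing by `(1 - X)^(t+1)` makes the coefficient of
`X^(w+t+1)` in `N_T - N_T'` a combination of the `w`-th coefficients of `(1 + 2X)^α (1 - X)^β`, with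
multipliers independent of `w` (`exists_coeff_coveringEnumerator_sub`). Since `C^⊥` has no nonzero
word of weight below `t + s`, the first `s - 1` of these combinations vanish. For `s ≤ 3` this
determines the multipliers up to a scalar, and the hypothesis on `w` says that the resulting
combination vanishes. -/

open Classical in
/-- The weight enumerator of `C` punctured at the coordinates in `T`. -/
noncomputable def puncturedEnumerator (C : Submodule (ZMod 3) (Fin n → ZMod 3))
    (T : Finset (Fin n)) : ℚ[X] :=
  ∑ c with c ∈ C, X ^ #(supp c \ T)

open Classical in
/-- The weight enumerator of the codewords of `C` whose support contains `S`. -/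
noncomputable def coveringEnumerator (C : Submodule (ZMod 3) (Fin n → ZMod 3))
    (S : Finset (Fin n)) : ℚ[X] :=
  ∑ c with c ∈ C ∧ S ⊆ supp c, X ^ #(supp c)

open Classical in
/-- The number of codewords of `C` of weight `u` that vanish on `T`. -/
noncomputable def shortenedCount (C : Submodule (ZMod 3) (Fin n → ZMod 3))
    (T : Finset (Fin n)) (u : ℕ) : ℕ :=
  #{c | c ∈ C ∧ #(supp c) = u ∧ Disjoint (supp c) T}

/-! ### Character sums and the MacWilliams identity for punctured duals -/

theorem mem_supp {c : Fin n → ZMod 3} {i : Fin n} : i ∈ supp c ↔ c i ≠ 0 := by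
  simp [supp]

theorem mem_dual {C : Submodule (ZMod 3) (Fin n → ZMod 3)} {x : Fin n → ZMod 3} :
    x ∈ dual C ↔ ∀ c ∈ C, ∑ i, x i * c i = 0 :=
  Iff.rfl

theorem supp_eq_empty {c : Fin n → ZMod 3} : supp c = ∅ ↔ c = 0 := by
  simp [Finset.ext_iff, mem_supp, funext_iff]

@[simp]
theorem supp_zero : supp (0 : Fin n → ZMod 3) = ∅ :=
  supp_eq_empty.2 rfl

theorem addChar_map_sum {ι A M : Type*} [AddCommMonoid A] [CommMonoid M] (ψ : AddChar A M)
    (s : Finset ι) (f : ι → A) : ψ (∑ i ∈ s, f i) = ∏ i ∈ s, ψ (f i) := by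
  classical
  induction s using Finset.induction_on with
  | empty => simp
  | insert a s ha ih => rw [sum_insert ha, prod_insert ha, AddChar.map_add_eq_mul, ih]

open Classical in
theorem sum_stdAddChar (C : Submodule (ZMod 3) (Fin n → ZMod 3)) (x : Fin n → ZMod 3) :
    ∑ c with c ∈ C, ZMod.stdAddChar (N := 3) (∑ i, x i * c i) =
      if x ∈ dual C then (#{c | c ∈ C} : ℂ) else 0 := by
  let φ : (Fin n → ZMod 3) →+ ZMod 3 :=
    { toFun := fun c => ∑ i, x i * c i
      map_zero' := by simp
      map_add' := by intro a b; simp [mul_add, sum_add_distrib] }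
  let χ : AddChar C ℂ :=
    (ZMod.stdAddChar (N := 3)).compAddMonoidHom (φ.comp C.subtype.toAddMonoidHom)
  have hχ : ∀ c : C, χ c = ZMod.stdAddChar (N := 3) (∑ i, x i * (c : Fin n → ZMod 3) i) :=
    fun _ => rfl
  have h := AddChar.sum_eq_ite χ
  have h1 : ∑ c with c ∈ C, ZMod.stdAddChar (N := 3) (∑ i, x i * c i) = ∑ c : C, χ c := by
    simp_rw [hχ]
    exact Finset.sum_subtype _ (by simp) _
  have h2 : χ = 0 ↔ x ∈ dual C := by
    rw [mem_dual, AddChar.eq_zero_iff]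
    refine ⟨fun h c hc => ?_, fun h c => ?_⟩
    · have := h ⟨c, hc⟩
      rw [hχ, ← AddChar.map_zero_eq_one (ZMod.stdAddChar (N := 3))] at this
      exact ZMod.injective_stdAddChar this
    · rw [hχ, h c c.2, AddChar.map_zero_eq_one]
  rw [h1, h]
  simp only [h2, Fintype.card_subtype]

/-- The one-coordinate Fourier transform behind the MacWilliams identity: the two nontrivial
character values sum to `-1`. -/
theorem sum_stdAddChar_mul_weight (b : ZMod 3) :
    ∑ a : ZMod 3, C (ZMod.stdAddChar (N := 3) (a * b)) * (if a ≠ 0 then (X : ℂ[X]) else 1) =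
      if b = 0 then 1 + 2 * X else 1 - X := by
  have h := AddChar.sum_mulShift b (ZMod.isPrimitive_stdAddChar 3)
  have hz : (univ : Finset (ZMod 3)) = {0, 1, 2} := by decide
  rw [hz] at h ⊢
  rw [sum_insert (by decide), sum_insert (by decide), sum_singleton] at h ⊢
  have h1 : (1 : ZMod 3) ≠ 0 := by decide
  have h2 : (2 : ZMod 3) ≠ 0 := by decide
  simp only [zero_mul, AddChar.map_zero_eq_one] at h
  simp only [zero_mul, AddChar.map_zero_eq_one, ne_eq, not_true_eq_false, if_false, h1, h2,
    not_false_eq_true, if_true, map_one, mul_one]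
  rw [← add_mul, ← C_add]
  have h3 := eq_sub_of_add_eq' h
  rw [h3]
  split_ifs
  · simp only [ZMod.card]
    norm_num
    rfl
  · simp; ring

open Classical in
theorem card_mul_puncturedEnumerator_dual (E : Submodule (ZMod 3) (Fin n → ZMod 3))
    (T : Finset (Fin n)) :
    (#{c | c ∈ E} : ℚ[X]) * puncturedEnumerator (dual E) T =
      3 ^ #T * ∑ c with c ∈ E ∧ Disjoint (supp c) T,
        (1 + 2 * X) ^ (n - #T - #(supp c)) * (1 - X) ^ #(supp c) := by
  -- The characters of `ZMod 3` take complex values, so the identity is checked over `ℂ`.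
  apply Polynomial.map_injective (algebraMap ℚ ℂ) (algebraMap ℚ ℂ).injective
  simp only [puncturedEnumerator, Polynomial.map_mul, Polynomial.map_sum, Polynomial.map_pow,
    Polynomial.map_add, Polynomial.map_sub, Polynomial.map_one, map_X, Polynomial.map_natCast,
    Polynomial.map_ofNat]
  have hfac (x c : Fin n → ZMod 3) :
      C (ZMod.stdAddChar (N := 3) (∑ i, x i * c i)) * (X : ℂ[X]) ^ #(supp x \ T) =
        ∏ i, C (ZMod.stdAddChar (N := 3) (x i * c i)) *
          (if i ∈ T then 1 else if x i ≠ 0 then X else 1) := by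
    rw [prod_mul_distrib, ← map_prod, addChar_map_sum]
    congr 1
    rw [← prod_const, ← prod_subset (subset_univ (supp x \ T))]
    · refine prod_congr rfl fun i hi => ?_
      rw [mem_sdiff, mem_supp] at hi
      rw [if_neg hi.2, if_pos hi.1]
    · intro i _ hi
      rw [mem_sdiff, mem_supp] at hi
      split_ifs <;> tauto
  -- A punctured coordinate has weight `1`, so its full character sum is `3` or `0`; this forces `c`
  -- to vanish on `T`.
  have hlocal (c : Fin n → ZMod 3) (i : Fin n) :
      ∑ a : ZMod 3, C (ZMod.stdAddChar (N := 3) (a * c i)) *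
          (if i ∈ T then 1 else if a ≠ 0 then (X : ℂ[X]) else 1) =
        if i ∈ T then (if c i = 0 then 3 else 0) else (if c i = 0 then 1 + 2 * X else 1 - X) := by
    by_cases hi : i ∈ T
    · simp only [hi, if_true, mul_one]
      rw [← map_sum, AddChar.sum_mulShift _ (ZMod.isPrimitive_stdAddChar 3)]
      split_ifs <;> simp [ZMod.card, map_ofNat C]
    · simp only [hi, if_false]
      exact sum_stdAddChar_mul_weight _
  have hprod (c : Fin n → ZMod 3) :
      ∏ i, (if i ∈ T then (if c i = 0 then (3 : ℂ[X]) else 0)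
          else (if c i = 0 then 1 + 2 * X else 1 - X)) =
        if Disjoint (supp c) T then
          3 ^ #T * ((1 + 2 * X) ^ (n - #T - #(supp c)) * (1 - X) ^ #(supp c)) else 0 := by
    split_ifs with hd
    · have h0 : ∀ i ∈ T, c i = 0 := fun i hi => by
        by_contra h
        exact disjoint_left.1 hd (mem_supp.2 h) hi
      rw [← prod_mul_prod_compl T]
      congr 1
      · rw [← prod_const]
        exact prod_congr rfl fun i hi => by rw [if_pos hi, if_pos (h0 i hi)]
      · have hsub : supp c ⊆ Tᶜ := subset_compl_iff_disjoint_right.2 hd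
        rw [← prod_sdiff hsub]
        congr 1
        · have : #(Tᶜ \ supp c) = n - #T - #(supp c) := by
            rw [card_sdiff_of_subset hsub, card_compl, Fintype.card_fin]
          rw [← this, ← prod_const]
          refine prod_congr rfl fun i hi => ?_
          rw [mem_sdiff, mem_compl, mem_supp, not_not] at hi
          rw [if_neg hi.1, if_pos hi.2]
        · rw [← prod_const]
          refine prod_congr rfl fun i hi => ?_
          rw [if_neg (mem_compl.1 (hsub hi)), if_neg (mem_supp.1 hi)]
    · obtain ⟨i, hi, hiT⟩ := not_disjoint_iff.1 hd
      exact prod_eq_zero (mem_univ i) (by rw [if_pos hiT, if_neg (mem_supp.1 hi)])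
  calc (#{c | c ∈ E} : ℂ[X]) * ∑ x with x ∈ dual E, X ^ #(supp x \ T)
      = ∑ x, (∑ c with c ∈ E, C (ZMod.stdAddChar (N := 3) (∑ i, x i * c i))) *
          X ^ #(supp x \ T) := by
        rw [mul_sum, sum_filter]
        refine sum_congr rfl fun x _ => ?_
        rw [← map_sum, sum_stdAddChar]
        split_ifs <;> simp
    _ = ∑ c with c ∈ E, ∑ x : Fin n → ZMod 3,
          ∏ i, C (ZMod.stdAddChar (N := 3) (x i * c i)) *
          (if i ∈ T then 1 else if x i ≠ 0 then X else 1) := by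
        simp_rw [sum_mul, hfac]
        rw [sum_comm]
    _ = ∑ c with c ∈ E, if Disjoint (supp c) T then
          3 ^ #T * ((1 + 2 * X) ^ (n - #T - #(supp c)) * (1 - X) ^ #(supp c)) else 0 := by
        refine sum_congr rfl fun c _ => ?_
        rw [← hprod]
        simp_rw [← hlocal]
        rw [prod_univ_sum, Fintype.piFinset_univ]
    _ = _ := by
        rw [← sum_filter, filter_filter, mul_sum]

/-! ### Punctured enumerators in terms of covering enumerators -/

/-- Inclusion-exclusion over the points of `T`. -/
theorem X_pow_mul_puncturedEnumerator (E : Submodule (ZMod 3) (Fin n → ZMod 3))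
    (T : Finset (Fin n)) :
    X ^ #T * puncturedEnumerator E T =
      ∑ S ∈ T.powerset, coveringEnumerator E S * ((1 - X) ^ #S * X ^ (#T - #S)) := by
  classical
  have hblock (b : Finset (Fin n)) : (X : ℚ[X]) ^ #T * X ^ #(b \ T) =
      ∑ S ∈ T.powerset, if S ⊆ b then X ^ #b * ((1 - X) ^ #S * X ^ (#T - #S)) else 0 := by
    have hfil : T.powerset.filter (· ⊆ b) = (T ∩ b).powerset := by
      ext S
      rw [mem_filter, mem_powerset, mem_powerset, subset_inter_iff]
    have hT : #T = #(T ∩ b) + #(T \ b) := by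
      rw [add_comm]; exact (card_sdiff_add_card_inter T b).symm
    have hb : #b = #(T ∩ b) + #(b \ T) := by
      rw [add_comm, inter_comm]; exact (card_sdiff_add_card_inter b T).symm
    -- Expand `1 = ((1 - X) + X)^|T ∩ b|` over the subsets of `T ∩ b`.
    have h := sum_pow_mul_eq_add_pow (1 - X : ℚ[X]) X (T ∩ b)
    rw [sub_add_cancel, one_pow] at h
    rw [← sum_filter, hfil]
    calc (X : ℚ[X]) ^ #T * X ^ #(b \ T) = X ^ #b * X ^ #(T \ b) * 1 := by
          rw [hT, hb]; ring
      _ = X ^ #b * X ^ #(T \ b) *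
          ∑ S ∈ (T ∩ b).powerset, (1 - X) ^ #S * X ^ (#(T ∩ b) - #S) := by rw [h]
      _ = _ := by
        rw [mul_sum]
        refine sum_congr rfl fun S hS => ?_
        have : #S ≤ #(T ∩ b) := card_le_card (mem_powerset.1 hS)
        rw [show #T - #S = #(T \ b) + (#(T ∩ b) - #S) by omega]
        ring
  simp only [puncturedEnumerator, coveringEnumerator, mul_sum, sum_mul, hblock]
  rw [sum_comm]
  refine sum_congr rfl fun S _ => ?_
  rw [← sum_filter, filter_filter]

/-! ### Uniqueness of the shortened weight distribution -/

/-- Each summand is an eigenvector, up to a common term, of `(1 + 2X)(1 - X) d/dX`. A first-order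
operator thus kills the summand at `a`, rescales the one at `d` by `3(a - d)`, and costs at most one
power of `X`; induct on `D`. -/
theorem eq_zero_of_X_pow_dvd_sum (m : ℕ) (D : Finset ℕ) :
    ∀ ε : ℕ → ℚ, (∀ d ∈ D, d ≤ m) →
      X ^ #D ∣ ∑ d ∈ D, C (ε d) * ((1 + 2 * X) ^ (m - d) * (1 - X) ^ d) → ∀ d ∈ D, ε d = 0 := by
  induction D using Finset.induction_on with
  | empty => simp
  | insert a D ha ih =>
    intro ε hD hdvd
    have hop (d : ℕ) (hd : d ≤ m) : (1 + 2 * X) * (1 - X) *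
        derivative ((1 + 2 * X : ℚ[X]) ^ (m - d) * (1 - X) ^ d) -
          (2 * (m : ℚ[X]) - 3 * (a : ℚ[X]) - 2 * (m : ℚ[X]) * X) *
            ((1 + 2 * X) ^ (m - d) * (1 - X) ^ d) =
        C (3 * ((a : ℚ) - d)) * ((1 + 2 * X) ^ (m - d) * (1 - X) ^ d) := by
      obtain ⟨e, rfl⟩ := Nat.exists_eq_add_of_le hd
      rw [Nat.add_sub_cancel_left, derivative_mul, derivative_pow, derivative_pow]
      have h1 : (1 + 2 * X : ℚ[X]) * (C (e : ℚ) * (1 + 2 * X) ^ (e - 1)) =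
          C (e : ℚ) * (1 + 2 * X) ^ e := by
        rcases e with _ | e
        · simp
        · rw [Nat.add_sub_cancel]; ring
      have h2 : (1 - X : ℚ[X]) * (C (d : ℚ) * (1 - X) ^ (d - 1)) =
          C (d : ℚ) * (1 - X) ^ d := by
        rcases d with _ | d
        · simp
        · rw [Nat.add_sub_cancel]; ring
      have h3 : derivative (1 + 2 * X : ℚ[X]) = 2 := by simp
      have h4 : derivative (1 - X : ℚ[X]) = -1 := by simp
      rw [h3, h4]
      simp only [map_mul, map_sub, map_natCast, map_ofNat] at h1 h2 ⊢
      push_cast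
      linear_combination 2 * (1 - X) ^ d * (1 - X) * h1 - (1 + 2 * X) ^ e * (1 + 2 * X) * h2
    rw [card_insert_of_notMem ha] at hdvd
    set F := ∑ d ∈ insert a D, C (ε d) * ((1 + 2 * X : ℚ[X]) ^ (m - d) * (1 - X) ^ d) with hF
    have hF' : (1 + 2 * X) * (1 - X) * derivative F - (2 * (m : ℚ[X]) - 3 * (a : ℚ[X]) - 2 * (m : ℚ[X]) * X) * F =
        ∑ d ∈ D, C (ε d * (3 * ((a : ℚ) - d))) * ((1 + 2 * X) ^ (m - d) * (1 - X) ^ d) := by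
      rw [hF, derivative_sum, mul_sum, mul_sum, ← sum_sub_distrib, sum_insert ha]
      have key : ∀ d ∈ insert a D, (1 + 2 * X) * (1 - X) *
          derivative (C (ε d) * ((1 + 2 * X : ℚ[X]) ^ (m - d) * (1 - X) ^ d)) -
          (2 * (m : ℚ[X]) - 3 * (a : ℚ[X]) - 2 * (m : ℚ[X]) * X) * (C (ε d) * ((1 + 2 * X) ^ (m - d) * (1 - X) ^ d)) =
          C (ε d * (3 * ((a : ℚ) - d))) * ((1 + 2 * X) ^ (m - d) * (1 - X) ^ d) := by
        intro d hd
        rw [derivative_C_mul, map_mul C, mul_assoc (C (ε d)), ← hop d (hD d hd)]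
        ring
      rw [key a (mem_insert_self a D), sub_self, mul_zero, mul_zero, C_0, zero_mul, zero_add]
      exact sum_congr rfl fun d hd => key d (mem_insert_of_mem hd)
    have hdF : X ^ #D ∣ derivative F := by
      obtain ⟨G, hG⟩ := hdvd
      rw [hG, derivative_mul, derivative_X_pow, Nat.add_sub_cancel]
      exact dvd_add (((Dvd.intro_left _ rfl).mul_right _)) ((pow_dvd_pow _ (Nat.le_succ _)).mul_right _)
    have h0 := ih (fun d => ε d * (3 * ((a : ℚ) - d))) (fun d hd => hD d (mem_insert_of_mem hd)) (by
      rw [← hF']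
      exact dvd_sub (hdF.mul_left _) (((pow_dvd_pow _ (Nat.le_succ _)).trans hdvd).mul_left _))
    have hz : ∀ d ∈ D, ε d = 0 := fun d hd => by
      have hne : (a : ℚ) - d ≠ 0 := by
        rw [sub_ne_zero]
        rintro h
        exact ha (by rwa [Nat.cast_injective h])
      simpa [hne] using h0 d hd
    -- Only the summand at `a` is left, and its constant term is `ε a`.
    have haz : ε a = 0 := by
      rw [hF, sum_insert ha, sum_eq_zero (fun d hd => by rw [hz d hd, C_0, zero_mul]), add_zero]
        at hdvd
      have := (dvd_pow_self X (Nat.succ_ne_zero _)).trans hdvd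
      rw [X_dvd_iff, coeff_zero_eq_eval_zero] at this
      simpa using this
    intro d hd
    rcases mem_insert.1 hd with rfl | hd
    exacts [haz, hz d hd]

theorem card_supp_le_of_disjoint {c : Fin n → ZMod 3} {T : Finset (Fin n)}
    (h : Disjoint (supp c) T) : #(supp c) ≤ n - #T := by
  have := card_le_card (subset_compl_iff_disjoint_right.2 h)
  rwa [card_compl, Fintype.card_fin] at this

theorem shortenedCount_eq_zero (E : Submodule (ZMod 3) (Fin n → ZMod 3)) {T : Finset (Fin n)}
    {u : ℕ} (h : n - #T < u) : shortenedCount E T u = 0 := by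
  classical
  rw [shortenedCount, card_eq_zero, filter_eq_empty_iff]
  rintro c - ⟨-, rfl, hd⟩
  exact absurd (card_supp_le_of_disjoint hd) (not_le.2 h)

open Classical in
theorem card_mul_puncturedEnumerator_dual_of_weights (E : Submodule (ZMod 3) (Fin n → ZMod 3))
    {D : Finset ℕ} {T : Finset (Fin n)} (h0 : 0 ∉ D)
    (hD : ∀ c ∈ E, c ≠ 0 → #(supp c) ≤ n - #T → #(supp c) ∈ D) :
    (#{c | c ∈ E} : ℚ[X]) * puncturedEnumerator (dual E) T =
      3 ^ #T * ((1 + 2 * X) ^ (n - #T) + ∑ d ∈ D, C (shortenedCount E T d : ℚ) *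
        ((1 + 2 * X) ^ (n - #T - d) * (1 - X) ^ d)) := by
  rw [card_mul_puncturedEnumerator_dual]
  congr 1
  rw [← sum_fiberwise_of_maps_to (t := insert 0 D) (g := fun c => #(supp c))]
  · have key (d : ℕ) : ∑ c ∈ {c | c ∈ E ∧ Disjoint (supp c) T} with #(supp c) = d,
        (1 + 2 * X : ℚ[X]) ^ (n - #T - #(supp c)) * (1 - X) ^ #(supp c) =
          C (shortenedCount E T d : ℚ) * ((1 + 2 * X) ^ (n - #T - d) * (1 - X) ^ d) := by
      rw [sum_congr rfl (g := fun _ => (1 + 2 * X : ℚ[X]) ^ (n - #T - d) * (1 - X) ^ d)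
        (fun c hc => by rw [(mem_filter.1 hc).2]), sum_const, nsmul_eq_mul, map_natCast,
        shortenedCount, filter_filter]
      congr 3
      ext c
      simp only [mem_filter]
      tauto
    have hzero : shortenedCount E T 0 = 1 := by
      rw [shortenedCount, card_eq_one]
      refine ⟨0, ?_⟩
      ext c
      simp only [mem_filter, mem_univ, true_and, mem_singleton, card_eq_zero, supp_eq_empty]
      constructor
      · exact fun h => h.2.1
      · rintro rfl
        exact ⟨E.zero_mem, rfl, by simp⟩
    rw [sum_insert h0, key, hzero, sum_congr rfl fun d _ => key d]
    simp
  · intro c hc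
    rw [mem_filter] at hc
    rw [mem_insert]
    rcases eq_or_ne c 0 with rfl | h
    · simp
    · exact Or.inr (hD c hc.2.1 h (card_supp_le_of_disjoint hc.2.2))

theorem X_pow_dvd_puncturedEnumerator_sub_one (E : Submodule (ZMod 3) (Fin n → ZMod 3))
    {T : Finset (Fin n)} {s : ℕ} (h : ∀ x ∈ E, x ≠ 0 → #T + s ≤ #(supp x)) :
    X ^ s ∣ puncturedEnumerator E T - 1 := by
  classical
  have h0 : (0 : Fin n → ZMod 3) ∈ ({c | c ∈ E} : Finset (Fin n → ZMod 3)) := by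
    simp
  rw [puncturedEnumerator, ← add_sum_erase _ _ h0, supp_zero, empty_sdiff, card_empty, pow_zero,
    add_sub_cancel_left]
  refine dvd_sum fun c hc => pow_dvd_pow _ ?_
  rw [mem_erase, mem_filter] at hc
  have h1 := h c hc.2.2 hc.1
  have h2 := le_card_sdiff T (supp c)
  omega

theorem card_codewords_ne_zero (E : Submodule (ZMod 3) (Fin n → ZMod 3))
    [DecidablePred (· ∈ E)] : #{c | c ∈ E} ≠ 0 :=
  card_ne_zero_of_mem (a := 0) (by simp)

/-- Puncturing `t` coordinates leaves each nonzero dual word with weight at least `#D`, so the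
difference of the two enumerators is divisible by `X ^ #D`, while it combines only `#D` MacWilliams
terms. -/
theorem puncturedEnumerator_dual_congr (E : Submodule (ZMod 3) (Fin n → ZMod 3))
    {D : Finset ℕ} {t : ℕ} (hDpos : 0 ∉ D) (hDle : ∀ d ∈ D, d ≤ n - t)
    (hD : ∀ c ∈ E, c ≠ 0 → #(supp c) ≤ n - t → #(supp c) ∈ D)
    (hdual : ∀ x ∈ dual E, x ≠ 0 → t + #D ≤ #(supp x))
    {T T' : Finset (Fin n)} (hT : #T = t) (hT' : #T' = t) :
    puncturedEnumerator (dual E) T = puncturedEnumerator (dual E) T' := by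
  classical
  have h1 := card_mul_puncturedEnumerator_dual_of_weights E (T := T) hDpos (by rwa [hT])
  have h2 := card_mul_puncturedEnumerator_dual_of_weights E (T := T') hDpos (by rwa [hT'])
  rw [hT] at h1
  rw [hT'] at h2
  have hsub : (#{c | c ∈ E} : ℚ[X]) *
      (puncturedEnumerator (dual E) T - puncturedEnumerator (dual E) T') =
      3 ^ t * ∑ d ∈ D, C ((shortenedCount E T d : ℚ) - shortenedCount E T' d) *
        ((1 + 2 * X) ^ (n - t - d) * (1 - X) ^ d) := by
    simp only [map_sub, sub_mul, sum_sub_distrib]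
    linear_combination h1 - h2
  have hdvd : X ^ #D ∣ puncturedEnumerator (dual E) T - puncturedEnumerator (dual E) T' := by
    rw [← sub_sub_sub_cancel_right _ _ 1]
    exact dvd_sub (X_pow_dvd_puncturedEnumerator_sub_one _ (by rwa [hT]))
      (X_pow_dvd_puncturedEnumerator_sub_one _ (by rwa [hT']))
  have h3 : IsUnit (3 ^ t : ℚ[X]) := by
    have : (3 : ℚ[X]) = C 3 := rfl
    rw [this, ← C_pow]
    exact isUnit_C.2 (by simp)
  have hdvd' : X ^ #D ∣ ∑ d ∈ D, C ((shortenedCount E T d : ℚ) - shortenedCount E T' d) *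
      ((1 + 2 * X) ^ (n - t - d) * (1 - X) ^ d) :=
    (h3.dvd_mul_left).1 (hsub ▸ hdvd.mul_left _)
  have hz := eq_zero_of_X_pow_dvd_sum (n - t) D _ hDle hdvd'
  rw [sum_eq_zero (fun d hd => by rw [hz d hd, C_0, zero_mul]), mul_zero] at hsub
  have hcard : (#{c | c ∈ E} : ℚ[X]) ≠ 0 := Nat.cast_ne_zero.2 (card_codewords_ne_zero E)
  exact sub_eq_zero.1 ((mul_eq_zero.1 hsub).resolve_left hcard)

/-! ### From punctured to covering enumerators -/

/-- If the covering enumerators of the smaller sets depend, up to `X ^ u`, on the cardinality only,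
then the punctured and covering enumerators of sets of size `k` determine each other up to
`X ^ (u + 1)`. -/
theorem X_pow_dvd_puncturedEnumerator_sub_coveringEnumerator
    (E : Submodule (ZMod 3) (Fin n → ZMod 3)) {k u : ℕ}
    (h : ∀ S S' : Finset (Fin n), #S = #S' → #S < k →
      X ^ u ∣ coveringEnumerator E S - coveringEnumerator E S')
    {T T' : Finset (Fin n)} (hT : #T = k) (hT' : #T' = k) :
    X ^ (u + 1) ∣ X ^ k * (puncturedEnumerator E T - puncturedEnumerator E T') -
      (1 - X) ^ k * (coveringEnumerator E T - coveringEnumerator E T') := by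
  classical
  -- A permutation carrying `T` to `T'` pairs their proper subsets, size by size.
  let e : T ≃ T' := Fintype.equivOfCardEq (by simp [hT, hT'])
  let σ : Equiv.Perm (Fin n) := e.extendSubtype
  have hσ : T.map σ.toEmbedding = T' := by
    refine eq_of_subset_of_card_le (fun i hi => ?_) (by rw [card_map, hT, hT'])
    obtain ⟨j, hj, rfl⟩ := mem_map.1 hi
    exact e.extendSubtype_mem j hj
  have hexp (T : Finset (Fin n)) (hT : #T = k) :
      X ^ k * puncturedEnumerator E T - (1 - X) ^ k * coveringEnumerator E T =
        ∑ S ∈ T.ssubsets, coveringEnumerator E S * ((1 - X) ^ #S * X ^ (k - #S)) := by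
    have := X_pow_mul_puncturedEnumerator E T
    rw [← insert_erase (mem_powerset_self T), sum_insert (notMem_erase _ _), hT, Nat.sub_self]
      at this
    rw [this, ssubsets]
    ring
  have hre : ∑ S ∈ T'.ssubsets, coveringEnumerator E S * ((1 - X) ^ #S * X ^ (k - #S)) =
      ∑ S ∈ T.ssubsets, coveringEnumerator E (S.map σ.toEmbedding) *
        ((1 - X) ^ #S * X ^ (k - #S)) := by
    symm
    refine sum_bij (fun S _ => S.map σ.toEmbedding) (fun S hS => ?_)
      (fun S _ S' _ h => map_injective _ h) (fun S hS => ?_) (fun S _ => by rw [card_map])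
    · rw [mem_ssubsets] at hS ⊢
      rw [← hσ]
      exact map_ssubset_map.2 hS
    · rw [mem_ssubsets] at hS
      refine ⟨S.map σ.symm.toEmbedding, ?_, ?_⟩
      · rw [mem_ssubsets, ← map_ssubset_map (f := σ.toEmbedding), hσ, map_map]
        simpa using hS
      · rw [map_map]; simp
  have : X ^ k * (puncturedEnumerator E T - puncturedEnumerator E T') -
      (1 - X) ^ k * (coveringEnumerator E T - coveringEnumerator E T') =
      ∑ S ∈ T.ssubsets, (coveringEnumerator E S - coveringEnumerator E (S.map σ.toEmbedding)) *
        ((1 - X) ^ #S * X ^ (k - #S)) := by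
    simp only [sub_mul, sum_sub_distrib]
    rw [← hre, ← hexp T hT, ← hexp T' hT']
    ring
  rw [this]
  refine dvd_sum fun S hS => ?_
  have hlt : #S < k := hT ▸ card_lt_card (mem_ssubsets.1 hS)
  -- The extra power of `X` comes from `X ^ (k - #S)`, as `S` is a proper subset.
  rw [pow_succ]
  refine mul_dvd_mul (h S _ (card_map _).symm hlt) (Dvd.dvd.mul_left (dvd_pow_self X ?_) _)
  omega

open Classical in
theorem coeff_coveringEnumerator (E : Submodule (ZMod 3) (Fin n → ZMod 3)) (S : Finset (Fin n))
    (u : ℕ) : (coveringEnumerator E S).coeff u = #{c | c ∈ E ∧ #(supp c) = u ∧ S ⊆ supp c} := by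
  rw [coveringEnumerator, finsetSum_coeff]
  simp only [coeff_X_pow]
  rw [← sum_filter, filter_filter, sum_const, nsmul_eq_mul, mul_one]
  congr 2
  ext c
  simp only [mem_filter, eq_comm (a := u)]
  tauto

/-- Double counting of the codewords of weight `u` covering `S` and one more coordinate. -/
theorem sum_coeff_coveringEnumerator_insert (E : Submodule (ZMod 3) (Fin n → ZMod 3))
    (S : Finset (Fin n)) (u : ℕ) :
    ∑ i ∈ Sᶜ, (coveringEnumerator E (insert i S)).coeff u =
      ((u : ℚ) - #S) * (coveringEnumerator E S).coeff u := by
  classical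
  simp only [coeff_coveringEnumerator, card_filter, Nat.cast_sum]
  rw [sum_comm, mul_sum]
  refine sum_congr rfl fun c _ => ?_
  by_cases h : c ∈ E ∧ #(supp c) = u ∧ S ⊆ supp c
  · rw [if_pos h]
    have : ∀ i ∈ Sᶜ, ((if c ∈ E ∧ #(supp c) = u ∧ insert i S ⊆ supp c then 1 else 0 : ℕ) : ℚ) =
        if i ∈ supp c \ S then 1 else 0 := by
      intro i hi
      rw [mem_compl] at hi
      simp [h, hi, insert_subset_iff]
    rw [sum_congr rfl this, sum_ite_mem, inter_eq_right.2 (fun i hi => by simp_all),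
      sum_const, card_sdiff_of_subset h.2.2, h.2.1, nsmul_eq_mul,
      Nat.cast_sub (h.2.1 ▸ card_le_card h.2.2)]
    simp
  · rw [if_neg h, Nat.cast_zero, mul_zero]
    refine sum_eq_zero fun i _ => ?_
    rw [if_neg fun h' => h ⟨h'.1, h'.2.1, (subset_insert _ _).trans h'.2.2⟩, Nat.cast_zero]

/-- A `t`-design is a `j`-design for `j ≤ t`: descend by double counting, dividing by `u - #S`,
which is nonzero once `t < u`. For `u ≤ t` only the zero codeword can contribute. -/
theorem coeff_coveringEnumerator_congr_of_top (E : Submodule (ZMod 3) (Fin n → ZMod 3))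
    {t u : ℕ} (hE : ∀ x ∈ E, x ≠ 0 → t < #(supp x))
    (htop : ∀ T T' : Finset (Fin n), #T = t → #T' = t →
      (coveringEnumerator E T).coeff u = (coveringEnumerator E T').coeff u) (htn : t ≤ n) :
    ∀ S S' : Finset (Fin n), #S = #S' → #S ≤ t →
      (coveringEnumerator E S).coeff u = (coveringEnumerator E S').coeff u := by
  classical
  have hsmall : u ≤ t → ∀ S : Finset (Fin n),
      (coveringEnumerator E S).coeff u = if u = 0 ∧ #S = 0 then 1 else 0 := by
    intro hu S
    rw [coeff_coveringEnumerator]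
    split_ifs with h
    · rw [Nat.cast_eq_one, card_eq_one]
      refine ⟨0, ?_⟩
      ext c
      simp only [mem_filter, mem_univ, true_and, mem_singleton, h.1, card_eq_zero, supp_eq_empty,
        card_eq_zero.1 h.2, empty_subset, and_true]
      exact ⟨fun h => h.2, fun h => ⟨h ▸ E.zero_mem, h⟩⟩
    · rw [Nat.cast_eq_zero, card_eq_zero, filter_eq_empty_iff]
      rintro c - ⟨hc, rfl, hS⟩
      rcases eq_or_ne c 0 with rfl | h0
      · simp_all
      · exact absurd (hE c hc h0) (not_lt.2 hu)
  rcases le_or_gt u t with hu | hu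
  · intro S S' hSS' _
    rw [hsmall hu, hsmall hu, hSS']
  have hdesc : ∀ j ≤ t, ∀ S S' : Finset (Fin n), #S = t - j → #S' = t - j →
      (coveringEnumerator E S).coeff u = (coveringEnumerator E S').coeff u := by
    intro j
    induction j with
    | zero => exact fun _ S S' h h' => htop S S' h h'
    | succ j ih =>
      intro hj S S' hS hS'
      have hstep (R : Finset (Fin n)) (hR : #R = t - (j + 1)) : ∀ i ∈ Rᶜ, #(insert i R) = t - j := by
        intro i hi
        rw [card_insert_of_notMem (mem_compl.1 hi), hR]
        omega
      have hne : Sᶜ.Nonempty := by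
        rw [← card_pos, card_compl, Fintype.card_fin]
        omega
      obtain ⟨i₀, hi₀⟩ := hne
      have hsum (R : Finset (Fin n)) (hR : #R = t - (j + 1)) :
          ((u : ℚ) - (t - (j + 1) : ℕ)) * (coveringEnumerator E R).coeff u =
            (n - (t - (j + 1)) : ℕ) * (coveringEnumerator E (insert i₀ S)).coeff u := by
        have := sum_coeff_coveringEnumerator_insert E R u
        rw [hR] at this
        rw [← this, sum_congr rfl fun i hi =>
          ih (by omega) _ _ (hstep R hR i hi) (hstep S hS i₀ hi₀), sum_const, card_compl,
          Fintype.card_fin, hR, nsmul_eq_mul]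
      have hne : (u : ℚ) - (t - (j + 1) : ℕ) ≠ 0 := by
        rw [sub_ne_zero, Ne, Nat.cast_inj]
        omega
      exact mul_left_cancel₀ hne ((hsum S hS).trans (hsum S' hS').symm)
  intro S S' hSS' hS
  exact hdesc (t - #S) (Nat.sub_le _ _) S S' (by omega) (by omega)

/-- Induction on the precision `X ^ u`: agreement for smaller sets gives one more coefficient for
`t`-sets, since `1 - X` is coprime to `X`, and double counting passes it down to the smaller sets.
-/
theorem coveringEnumerator_congr_of_puncturedEnumerator_congr
    (E : Submodule (ZMod 3) (Fin n → ZMod 3)) {t : ℕ} (htn : t ≤ n)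
    (hE : ∀ x ∈ E, x ≠ 0 → t < #(supp x))
    (hP : ∀ T T' : Finset (Fin n), #T = t → #T' = t →
      puncturedEnumerator E T = puncturedEnumerator E T') :
    ∀ S S' : Finset (Fin n), #S = #S' → #S ≤ t →
      coveringEnumerator E S = coveringEnumerator E S' := by
  have key : ∀ u, ∀ S S' : Finset (Fin n), #S = #S' → #S ≤ t →
      X ^ u ∣ coveringEnumerator E S - coveringEnumerator E S' := by
    intro u
    induction u with
    | zero => simp
    | succ u ih =>
      have htop : ∀ T T' : Finset (Fin n), #T = t → #T' = t →
          (coveringEnumerator E T).coeff u = (coveringEnumerator E T').coeff u := by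
        intro T T' hT hT'
        have h := X_pow_dvd_puncturedEnumerator_sub_coveringEnumerator E
          (fun S S' h h' => ih S S' h h'.le) hT hT'
        rw [hP T T' hT hT', sub_self, mul_zero, zero_sub, dvd_neg] at h
        have hcop : IsCoprime ((X : ℚ[X]) ^ (u + 1)) ((1 - X) ^ t) :=
          IsCoprime.pow ⟨1, 1, by ring⟩
        have := X_pow_dvd_iff.1 (hcop.dvd_of_dvd_mul_left h) u (Nat.lt_succ_self u)
        rwa [coeff_sub, sub_eq_zero] at this
      intro S S' hSS' hS
      rw [X_pow_dvd_iff]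
      intro v hv
      rcases Nat.lt_succ_iff_lt_or_eq.1 hv with hv | rfl
      · exact X_pow_dvd_iff.1 (ih S S' hSS' hS) v hv
      · rw [coeff_sub, sub_eq_zero]
        exact coeff_coveringEnumerator_congr_of_top E hE htop htn S S' hSS' hS
  intro S S' hSS' hS
  ext u
  have := X_pow_dvd_iff.1 (key (u + 1) S S' hSS' hS) u (Nat.lt_succ_self u)
  rwa [coeff_sub, sub_eq_zero] at this

/-! ### Power series expansions and sets of size `t + 1` -/

/-- The coefficient of `X ^ w` in the expansion of `(1 + 2 X) ^ a * (1 - X) ^ b`. -/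
noncomputable def expansionCoeff (a b : ℤ) (w : ℕ) : ℤ :=
  ∑ p ∈ antidiagonal w, 2 ^ p.1 * Ring.choose a p.1 * ((-1) ^ p.2 * Ring.choose b p.2)

theorem expansionCoeff_zero (a b : ℤ) : expansionCoeff a b 0 = 1 := by
  simp [expansionCoeff]

theorem expansionCoeff_one (a b : ℤ) : expansionCoeff a b 1 = 2 * a - b := by
  simp [expansionCoeff, Nat.antidiagonal_succ]
  ring

/-- The power series `(1 + 2 X) ^ a * (1 - X) ^ b`. -/
noncomputable def expansionSeries (a b : ℤ) : PowerSeries ℚ :=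
  PowerSeries.rescale 2 (PowerSeries.binomialSeries ℚ a) *
    PowerSeries.rescale (-1) (PowerSeries.binomialSeries ℚ b)

theorem coeff_expansionSeries (a b : ℤ) (w : ℕ) :
    PowerSeries.coeff w (expansionSeries a b) = expansionCoeff a b w := by
  simp [expansionSeries, expansionCoeff, PowerSeries.coeff_mul]

theorem expansionSeries_mul (a b : ℤ) (e d k : ℕ) (ha : a = e) (hb : b + k = d) :
    expansionSeries a b * (1 - PowerSeries.X) ^ k =
      (1 + 2 * PowerSeries.X) ^ e * (1 - PowerSeries.X) ^ d := by
  have h2 : PowerSeries.rescale (2 : ℚ) (1 + PowerSeries.X) = 1 + 2 * PowerSeries.X := by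
    rw [map_add, map_one, PowerSeries.rescale_X]; rfl
  have h1 : PowerSeries.rescale (-1 : ℚ) (1 + PowerSeries.X) = 1 - PowerSeries.X := by
    rw [map_add, map_one, PowerSeries.rescale_X]; simp [sub_eq_add_neg]
  rw [expansionSeries, ha, ← h1, ← map_pow, mul_assoc, ← map_mul,
    ← PowerSeries.binomialSeries_nat (R := ℤ), ← PowerSeries.binomialSeries_add, hb,
    PowerSeries.binomialSeries_nat, PowerSeries.binomialSeries_nat, map_pow, map_pow, h1, h2]

theorem exists_coeff_coveringEnumerator_sub (E : Submodule (ZMod 3) (Fin n → ZMod 3))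
    {D : Finset ℕ} {t : ℕ} (hDpos : 0 ∉ D) (hDle : ∀ d ∈ D, d ≤ n - t)
    (hD : ∀ c ∈ E, c ≠ 0 → #(supp c) ≤ n - t → #(supp c) ∈ D) (hDne : D.Nonempty)
    (hdual : ∀ x ∈ dual E, x ≠ 0 → t + #D ≤ #(supp x))
    {T T' : Finset (Fin n)} (hT : #T = t + 1) (hT' : #T' = t + 1) :
    ∃ ε : ℕ → ℚ, ∀ w : ℕ,
      (coveringEnumerator (dual E) T).coeff (w + (t + 1)) -
        (coveringEnumerator (dual E) T').coeff (w + (t + 1)) =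
      ∑ d ∈ D, ε d * expansionCoeff ((n : ℤ) - d - (t + 1)) ((d : ℤ) - (t + 1)) w := by
  classical
  have htn : t + 1 ≤ n := by
    have := card_le_univ T
    rwa [hT, Fintype.card_fin] at this
  have hDcard : 0 < #D := card_pos.2 hDne
  have hcov := coveringEnumerator_congr_of_puncturedEnumerator_congr (dual E) (by omega : t ≤ n)
    (fun x hx h0 => by have := hdual x hx h0; omega)
    (fun T T' hT hT' => puncturedEnumerator_dual_congr E hDpos hDle hD hdual hT hT')
  have hPN : X ^ (t + 1) * (puncturedEnumerator (dual E) T - puncturedEnumerator (dual E) T') =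
      (1 - X) ^ (t + 1) * (coveringEnumerator (dual E) T - coveringEnumerator (dual E) T') := by
    rw [← sub_eq_zero]
    ext u
    refine X_pow_dvd_iff.1 (X_pow_dvd_puncturedEnumerator_sub_coveringEnumerator (u := u) (dual E)
      (fun S S' h h' => ?_) hT hT') u (Nat.lt_succ_self u)
    rw [hcov S S' h (by omega), sub_self]
    exact dvd_zero _
  have hD' : ∀ c ∈ E, c ≠ 0 → #(supp c) ≤ n - (t + 1) → #(supp c) ∈ D :=
    fun c hc h0 h => hD c hc h0 (by omega)
  have h1 := card_mul_puncturedEnumerator_dual_of_weights E (T := T) hDpos (by rwa [hT])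
  have h2 := card_mul_puncturedEnumerator_dual_of_weights E (T := T') hDpos (by rwa [hT'])
  rw [hT] at h1
  rw [hT'] at h2
  set η : ℕ → ℚ := fun d => (shortenedCount E T d : ℚ) - shortenedCount E T' d with hη
  have hsub : (#{c | c ∈ E} : ℚ[X]) *
      (puncturedEnumerator (dual E) T - puncturedEnumerator (dual E) T') =
      3 ^ (t + 1) * ∑ d ∈ D, C (η d) * ((1 + 2 * X) ^ (n - (t + 1) - d) * (1 - X) ^ d) := by
    simp only [hη, map_sub, sub_mul, sum_sub_distrib]
    linear_combination h1 - h2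
  have hmain : (1 - X) ^ (t + 1) * ((#{c | c ∈ E} : ℚ[X]) *
      (coveringEnumerator (dual E) T - coveringEnumerator (dual E) T')) =
      X ^ (t + 1) * (3 ^ (t + 1) *
        ∑ d ∈ D, C (η d) * ((1 + 2 * X) ^ (n - (t + 1) - d) * (1 - X) ^ d)) := by
    rw [← hsub]
    linear_combination -(#{c | c ∈ E} : ℚ[X]) * hPN
  have hser := congrArg (Polynomial.coeToPowerSeries.ringHom (R := ℚ)) hmain
  simp only [map_mul, map_pow, map_sub, map_one, map_sum, map_add, map_natCast, map_ofNat,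
    Polynomial.coeToPowerSeries.ringHom_apply, Polynomial.coe_X, Polynomial.coe_C] at hser
  have hterm : ∀ d ∈ D, PowerSeries.C (η d) * ((1 + 2 * PowerSeries.X) ^ (n - (t + 1) - d) *
      (1 - PowerSeries.X) ^ d) = (1 - PowerSeries.X) ^ (t + 1) * (PowerSeries.C (η d) *
        expansionSeries ((n : ℤ) - d - (t + 1)) ((d : ℤ) - (t + 1))) := by
    intro d _
    rcases le_or_gt d (n - (t + 1)) with h | h
    · rw [← expansionSeries_mul ((n : ℤ) - d - (t + 1)) ((d : ℤ) - (t + 1))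
        (n - (t + 1) - d) d (t + 1) (by omega) (by push_cast; ring)]
      ring
    -- Here `d = n - t`, so the first exponent is `-1`; but no codeword of that weight vanishes on
    -- `t + 1` coordinates.
    · have : η d = 0 := by
        simp only [hη]
        rw [shortenedCount_eq_zero E (by rwa [hT]), shortenedCount_eq_zero E (by rwa [hT']),
          sub_self]
      rw [this, map_zero, zero_mul, zero_mul, mul_zero]
  rw [sum_congr rfl hterm, ← mul_sum] at hser
  have hunit : ((1 : PowerSeries ℚ) - PowerSeries.X) ^ (t + 1) ≠ 0 := by
    refine pow_ne_zero _ fun h => ?_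
    have := congrArg PowerSeries.constantCoeff h
    simp at this
  have hcancel : (#{c | c ∈ E} : PowerSeries ℚ) *
      ((coveringEnumerator (dual E) T : PowerSeries ℚ) -
        (coveringEnumerator (dual E) T' : PowerSeries ℚ)) =
      PowerSeries.X ^ (t + 1) * (3 ^ (t + 1) * ∑ d ∈ D, PowerSeries.C (η d) *
        expansionSeries ((n : ℤ) - d - (t + 1)) ((d : ℤ) - (t + 1))) := by
    apply mul_left_cancel₀ hunit
    rw [hser]
    ring
  have hcard : (#{c | c ∈ E} : ℚ) ≠ 0 := Nat.cast_ne_zero.2 (card_codewords_ne_zero E)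
  refine ⟨fun d => 3 ^ (t + 1) / (#{c | c ∈ E} : ℚ) * η d, fun w => ?_⟩
  have hc := congrArg (PowerSeries.coeff (w + (t + 1))) hcancel
  have e1 : (#{c | c ∈ E} : PowerSeries ℚ) = PowerSeries.C (#{c | c ∈ E} : ℚ) := by simp
  have e2 : (3 ^ (t + 1) : PowerSeries ℚ) = PowerSeries.C (3 ^ (t + 1) : ℚ) := by
    rw [map_pow]; rfl
  rw [PowerSeries.coeff_X_pow_mul, e1, e2, PowerSeries.coeff_C_mul, PowerSeries.coeff_C_mul,
    map_sub, map_sum, Polynomial.coeff_coe, Polynomial.coeff_coe] at hc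
  simp only [PowerSeries.coeff_C_mul, coeff_expansionSeries] at hc
  simp only [mul_assoc]
  rw [← mul_sum]
  field_simp
  linear_combination hc

/-! ### Enumeration of the weights and the design criterion -/

theorem weightClass_nonempty {E : Submodule (ZMod 3) (Fin n → ZMod 3)} {u : ℕ} :
    (weightClass E u).Nonempty ↔ ∃ c ∈ E, #(supp c) = u := by
  simp only [weightClass, Finset.Nonempty, mem_filter, mem_univ, true_and]
  rfl

theorem minDist_le_card_supp {E : Submodule (ZMod 3) (Fin n → ZMod 3)} {x : Fin n → ZMod 3}
    (hx : x ∈ E) (h0 : x ≠ 0) : minDist E ≤ #(supp x) :=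
  Nat.sInf_le ⟨x, hx, h0, rfl⟩

open Classical in
theorem weights_eq_image_weight (E : Submodule (ZMod 3) (Fin n → ZMod 3)) {m s : ℕ}
    (hs : #{u ∈ Icc 1 m | (weightClass E u).Nonempty} = s) :
    {u ∈ Icc 1 m | (weightClass E u).Nonempty} = (Icc 1 s).image (weight E) ∧
      Set.InjOn (weight E) (Icc 1 s) := by
  set p : ℕ → Prop := fun u => (weightClass E u).Nonempty with hp
  have hp0 : p 0 := weightClass_nonempty.2 ⟨0, E.zero_mem, by simp⟩
  -- The extra `1` is the weight `0`, which takes index `0` in `Nat.nth`.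
  have hcount : Nat.count p (m + 1) = s + 1 := by
    rw [Nat.count_eq_card_filter_range, ← hs]
    have : {u ∈ range (m + 1) | p u} = insert 0 {u ∈ Icc 1 m | p u} := by
      ext u
      simp only [mem_filter, mem_range, mem_insert, mem_Icc]
      constructor
      · rintro ⟨h, h'⟩
        rcases Nat.eq_zero_or_pos u with rfl | hu
        · exact Or.inl rfl
        · exact Or.inr ⟨⟨hu, by omega⟩, h'⟩
      · rintro (rfl | ⟨h, h'⟩)
        · exact ⟨by omega, hp0⟩
        · exact ⟨by omega, h'⟩
    rw [this, card_insert_of_notMem (by simp)]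
  have hsub : {u ∈ Icc 1 m | p u} ⊆ (Icc 1 s).image (weight E) := by
    intro u hu
    rw [mem_filter, mem_Icc] at hu
    refine mem_image.2 ⟨Nat.count p u, ?_, Nat.nth_count hu.2⟩
    have h1 := Nat.count_strict_mono hu.2 (by omega : u < m + 1)
    have h2 := Nat.count_strict_mono hp0 (by omega : 0 < u)
    rw [mem_Icc]
    omega
  have himg : #((Icc 1 s).image (weight E)) ≤ s := card_image_le.trans (by simp)
  have heq := eq_of_subset_of_card_le hsub (by rw [hs]; exact himg)
  refine ⟨heq, card_image_iff.1 ?_⟩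
  rw [← heq, hs]
  simp

open Classical in
theorem card_weights_of_AMCondition {E : Submodule (ZMod 3) (Fin n → ZMod 3)} {t s : ℕ}
    (hAM : AMCondition E t) (hs : (minDist (dual E) : ℤ) - t = s) :
    #{u ∈ Icc 1 (n - t) | (weightClass E u).Nonempty} = s := by
  rw [AMCondition, hs] at hAM
  exact_mod_cast hAM.symm

theorem isDesign_supportDesign (E : Submodule (ZMod 3) (Fin n → ZMod 3)) {k u : ℕ} (hk : k ≤ u)
    (h : ∀ T T' : Finset (Fin n), #T = k → #T' = k →
      (coveringEnumerator E T).coeff u = (coveringEnumerator E T').coeff u)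
    (hne : (weightClass E u).Nonempty) : IsDesign k (supportDesign E u) := by
  classical
  have hcount (T : Finset (Fin n)) :
      (((supportDesign E u).filter fun b => T ⊆ b).card : ℚ) = (coveringEnumerator E T).coeff u := by
    rw [coeff_coveringEnumerator, supportDesign, Multiset.filter_map, Multiset.card_map]
    congr 1
    change #((weightClass E u).filter fun c => T ⊆ supp c) = _
    congr 1
    ext c
    simp only [weightClass, mem_filter, mem_univ, true_and, and_assoc]
    rfl
  obtain ⟨c, hc, rfl⟩ := weightClass_nonempty.1 hne
  obtain ⟨T₀, hT₀, hcard⟩ := exists_subset_card_eq hk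
  refine ⟨#(supp c), ((supportDesign E #(supp c)).filter fun b => T₀ ⊆ b).card, hk, ?_, ?_, ?_⟩
  · rw [Multiset.card_pos_iff_exists_mem]
    refine ⟨supp c, Multiset.mem_filter.2 ⟨Multiset.mem_map.2 ⟨c, ?_, rfl⟩, hT₀⟩⟩
    exact mem_filter.2 ⟨mem_univ _, hc, rfl⟩
  · intro b hb
    obtain ⟨x, hx, rfl⟩ := Multiset.mem_map.1 hb
    exact (mem_filter.1 hx).2.2
  · intro T hT
    have := h T T₀ hT hcard
    rw [← hcount, ← hcount] at this
    exact_mod_cast this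

/-- A linear relation among the expansions at the first `s` weights of `E` that follows from their
initial coefficients makes the support design of the dual code a `(t + 1)`-design. -/
theorem isDesign_of_forall_sum_eq_zero (E : Submodule (ZMod 3) (Fin n → ZMod 3)) {t s : ℕ}
    (hAM : AMCondition E t) (hs : (minDist (dual E) : ℤ) - t = s) (hs0 : 0 < s) {w : ℕ}
    (hw : ∀ e : ℕ → ℚ,
      (∀ v, v + 1 < s → ∑ l ∈ Icc 1 s, e l * expansionCoeff ((n : ℤ) - weight E l - (t + 1))
        ((weight E l : ℤ) - (t + 1)) v = 0) →
      ∑ l ∈ Icc 1 s, e l * expansionCoeff ((n : ℤ) - weight E l - (t + 1))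
        ((weight E l : ℤ) - (t + 1)) w = 0)
    (hne : (weightClass (dual E) (w + t + 1)).Nonempty) :
    IsDesign (t + 1) (supportDesign (dual E) (w + t + 1)) := by
  classical
  set D : Finset ℕ := {u ∈ Icc 1 (n - t) | (weightClass E u).Nonempty} with hDdef
  have hcard : #D = s := card_weights_of_AMCondition hAM hs
  obtain ⟨himg, hinj⟩ := weights_eq_image_weight E hcard
  have hdual : ∀ x ∈ dual E, x ≠ 0 → t + #D ≤ #(supp x) := fun x hx h0 => by
    have := minDist_le_card_supp hx h0
    omega
  refine isDesign_supportDesign _ (by omega) (fun T T' hT hT' => ?_) hne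
  obtain ⟨ε, hε⟩ := exists_coeff_coveringEnumerator_sub E (D := D) (t := t) (by simp [hDdef])
    (fun d hd => (mem_Icc.1 (mem_filter.1 hd).1).2)
    (fun c hc h0 h => by
      refine mem_filter.2 ⟨mem_Icc.2 ⟨?_, h⟩, weightClass_nonempty.2 ⟨c, hc, rfl⟩⟩
      exact card_pos.2 (nonempty_iff_ne_empty.2 (mt supp_eq_empty.1 h0)))
    (card_pos.1 (by omega)) hdual hT hT'
  have hsum (v : ℕ) := hε v
  rw [hDdef, himg] at hsum
  simp only [sum_image hinj] at hsum
  -- The weight `v + t + 1` lies strictly between `0` and `d^⊥ = t + s`.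
  have hlow (v : ℕ) (hv : v + 1 < s) (S : Finset (Fin n)) :
      (coveringEnumerator (dual E) S).coeff (v + (t + 1)) = 0 := by
    rw [coeff_coveringEnumerator, Nat.cast_eq_zero, card_eq_zero, filter_eq_empty_iff]
    rintro c - ⟨hc, hcw, -⟩
    rcases eq_or_ne c 0 with rfl | h0
    · rw [supp_zero, card_empty] at hcw
      omega
    · have := hdual c hc h0
      omega
  have := hw (fun l => ε (weight E l)) fun v hv => by
    rw [← hsum v, hlow v hv, hlow v hv, sub_self]
  rw [← hsum w, sub_eq_zero] at this
  exact this

end TernaryCode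

/-! ### The cases `s = 1, 2, 3` -/

theorem theorem4 {n : ℕ} (C : Submodule (ZMod 3) (Fin n → ZMod 3)) (t : ℕ)
    (hAM : TernaryCode.AMCondition C t)
    (d : ℕ → ℕ) (hd : ∀ l, d l = TernaryCode.weight C l)
    (α β : ℕ → ℤ) (hα : ∀ l, α l = (n : ℤ) - d l - (t + 1)) (hβ : ∀ l, β l = (d l : ℤ) - (t + 1)) :
    ((TernaryCode.minDist (TernaryCode.dual C) : ℤ) - t = 1 →
      ∀ w : ℕ,
        (∑ p ∈ Finset.HasAntidiagonal.antidiagonal w,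
          2 ^ p.1 * Ring.choose (α 1) p.1 * ((-1) ^ p.2 * Ring.choose (β 1) p.2)) = 0 →
        (TernaryCode.weightClass (TernaryCode.dual C) (w + t + 1)).Nonempty →
        TernaryCode.IsDesign (t + 1)
          (TernaryCode.supportDesign (TernaryCode.dual C) (w + t + 1))) ∧
    ((TernaryCode.minDist (TernaryCode.dual C) : ℤ) - t = 2 →
      ∀ w : ℕ,
        (∑ p ∈ Finset.HasAntidiagonal.antidiagonal w,
          (2 ^ p.1 * Ring.choose (α 1) p.1 * ((-1) ^ p.2 * Ring.choose (β 1) p.2)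
            - 2 ^ p.1 * Ring.choose (α 2) p.1 * ((-1) ^ p.2 * Ring.choose (β 2) p.2))) = 0 →
        (TernaryCode.weightClass (TernaryCode.dual C) (w + t + 1)).Nonempty →
        TernaryCode.IsDesign (t + 1)
          (TernaryCode.supportDesign (TernaryCode.dual C) (w + t + 1))) ∧
    ((TernaryCode.minDist (TernaryCode.dual C) : ℤ) - t = 3 →
      ∀ w : ℕ,
        (∑ p ∈ Finset.HasAntidiagonal.antidiagonal w,
          ((2 : ℚ) ^ p.1 * (Ring.choose (α 1) p.1 : ℤ)
              * ((-1) ^ p.2 * (Ring.choose (β 1) p.2 : ℤ))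
            - ((d 3 : ℚ) - d 1) / ((d 3 : ℚ) - d 2)
              * (2 ^ p.1 * (Ring.choose (α 2) p.1 : ℤ)
                * ((-1) ^ p.2 * (Ring.choose (β 2) p.2 : ℤ)))
            + ((d 2 : ℚ) - d 1) / ((d 3 : ℚ) - d 2)
              * (2 ^ p.1 * (Ring.choose (α 3) p.1 : ℤ)
                * ((-1) ^ p.2 * (Ring.choose (β 3) p.2 : ℤ))))) = 0 →
        (TernaryCode.weightClass (TernaryCode.dual C) (w + t + 1)).Nonempty →
        TernaryCode.IsDesign (t + 1)
          (TernaryCode.supportDesign (TernaryCode.dual C) (w + t + 1))) := by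
  have hc1 (a b : ℤ) (m dl : ℕ) (ha : a = m - dl - (t + 1)) (hb : b = dl - (t + 1)) :
      (TernaryCode.expansionCoeff a b 1 : ℚ) = 2 * m - 3 * dl - (t + 1) := by
    rw [TernaryCode.expansionCoeff_one, ha, hb]
    push_cast
    ring
  refine ⟨fun hs w hw hne => ?_, fun hs w hw hne => ?_, fun hs w hw hne => ?_⟩
  · refine TernaryCode.isDesign_of_forall_sum_eq_zero C (s := 1) hAM hs one_pos (fun e _ => ?_) hne
    simp only [← hd, ← hα, ← hβ]
    change TernaryCode.expansionCoeff _ _ w = 0 at hw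
    simp [hw]
  · refine TernaryCode.isDesign_of_forall_sum_eq_zero C (s := 2) hAM hs two_pos (fun e he => ?_) hne
    have hI : Finset.Icc 1 2 = ({1, 2} : Finset ℕ) := rfl
    simp only [← hd, ← hα, ← hβ, hI, Finset.sum_pair (by decide : (1 : ℕ) ≠ 2)] at he ⊢
    rw [Finset.sum_sub_distrib] at hw
    change TernaryCode.expansionCoeff _ _ w - TernaryCode.expansionCoeff _ _ w = 0 at hw
    have h0 := he 0 (by norm_num)
    simp only [TernaryCode.expansionCoeff_zero, Int.cast_one, mul_one] at h0
    rw [sub_eq_zero.1 hw]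
    linear_combination (TernaryCode.expansionCoeff (α 2) (β 2) w : ℚ) * h0
  · have hinj := (TernaryCode.weights_eq_image_weight C
      (TernaryCode.card_weights_of_AMCondition (s := 3) hAM hs)).2
    have h23 : (d 3 : ℚ) - d 2 ≠ 0 := by
      rw [sub_ne_zero, Ne, Nat.cast_inj, hd, hd]
      intro h
      exact absurd (hinj (by simp) (by simp) h) (by decide)
    refine TernaryCode.isDesign_of_forall_sum_eq_zero C (s := 3) hAM hs three_pos
      (fun e he => ?_) hne
    have hI : Finset.Icc 1 3 = ({1, 2, 3} : Finset ℕ) := rfl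
    have hsum (f : ℕ → ℚ) : ∑ l ∈ Finset.Icc 1 3, f l = f 1 + f 2 + f 3 := by
      rw [hI, Finset.sum_insert (by decide), Finset.sum_pair (by decide), add_assoc]
    simp only [← hd, ← hα, ← hβ, hsum] at he ⊢
    have hcast (l : ℕ) : (TernaryCode.expansionCoeff (α l) (β l) w : ℚ) =
        ∑ p ∈ Finset.HasAntidiagonal.antidiagonal w, (2 : ℚ) ^ p.1 * (Ring.choose (α l) p.1 : ℤ)
          * ((-1) ^ p.2 * (Ring.choose (β l) p.2 : ℤ)) := by
      rw [TernaryCode.expansionCoeff]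
      push_cast
      rfl
    rw [Finset.sum_add_distrib, Finset.sum_sub_distrib, ← Finset.mul_sum, ← Finset.mul_sum,
      ← hcast, ← hcast, ← hcast] at hw
    have h0 := he 0 (by norm_num)
    have h1 := he 1 (by norm_num)
    simp only [TernaryCode.expansionCoeff_zero, Int.cast_one, mul_one] at h0
    rw [hc1 _ _ n (d 1) (hα 1) (hβ 1), hc1 _ _ n (d 2) (hα 2) (hβ 2),
      hc1 _ _ n (d 3) (hα 3) (hβ 3)] at h1
    -- The relations `h0` and `h1` amount to `∑ e l = 0` and `∑ e l * d l = 0`; solving them for `e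
    -- 2` and `e 3` yields the coefficients in `hw`.
    have e2 : e 2 = -(e 1 * (((d 3 : ℚ) - d 1) / ((d 3 : ℚ) - d 2))) := by
      field_simp
      linear_combination (2 * n - 3 * d 3 - (t + 1) : ℚ) / (-3) * h0 + h1 / 3
    have e3 : e 3 = e 1 * (((d 2 : ℚ) - d 1) / ((d 3 : ℚ) - d 2)) := by
      field_simp
      linear_combination (2 * n - 3 * d 2 - (t + 1) : ℚ) / 3 * h0 - h1 / 3
    rw [e2, e3]
    linear_combination e 1 * hw
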